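/- Let $\lambda$ be a regular uncountable cardinal with $\lambda^{<\lambda}=\lambda$; in forcing, larger conditions are stronger. **Trees.** For sequences write $s\trianglelefteq t$ ($s\vartriangleleft t$) if $s$ is an initial (proper initial) segment of $t$. A complete $\lambda$-tree is a $\trianglelefteq$-downward closed set $T\subseteq{}^{<\lambda}\lambda$ such that every $\vartriangleleft$-chain in $T$ of size less than $\lambda$ (including the empty one) has an upper bound in $T$ and every $t\in T$ has a proper extension in $T$. For $t\in T$ put $\mathrm{succ}_T(t)=\{\alpha<\lambda: t^\frown\langle\alpha\rangle\in T\}$, and let $\lim_\lambda(T)=\{\eta\in{}^\lambda\lambda:(\forall\alpha<\lambda)\ \eta{\restriction}\alpha\in T\}$. Let $\mathbb T^{\rm club}$ be the family of all complete $\lambda$-trees $T$ such that for every $t\in T$ the set $\mathrm{succ}_T(t)$ either has exactly one element or is a club of $\lambda$, and there is $s\in T$ with $t\vartriangleleft s$ and $|\mathrm{succ}_T(s)|>1$. * $\mathbb Q^1_\lambda$ is the set of all $T\in\mathbb T^{\rm club}$ such that for every $\eta\in\lim_\lambda(T)$ the set $\{\alpha<\lambda:|\mathrm{succ}_T(\eta{\restriction}\alpha)|>1\}$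 contains a club of $\lambda$. * $\mathbb Q^2_\lambda$ is the set of all $T\in\mathbb T^{\rm club}$ such that whenever $0<j<\lambda$ and $\langle t_i:i<j\rangle\subseteq T$ is $\vartriangleleft$-increasing with $|\mathrm{succ}_T(t_i)|>1$ for all $i<j$, then $t=\bigcup_{i<j}t_i$ belongs to $T$ and $|\mathrm{succ}_T(t)|>1$. Both are ordered by inverse inclusion: $T_1\le T_2$ if and only if $T_2\subseteq T_1$. **The axiom.** Let $\mathbb C_\lambda$ be ${}^{<\lambda}\lambda$ ordered by $\trianglelefteq$ ($\lambda$-Cohen forcing). A name for a subset of $\lambda$ is a set $\dot S$ of pairs $(\check\alpha,p)$ with $\alpha<\lambda$, $p\in\mathbb C_\lambda$; for $H\subseteq\mathbb C_\lambda$ let $\dot S[H]=\{\alpha:(\exists p\in H)\ (\check\alpha,p)\in\dot S\}$. The axiom ${\rm Ax}^+_{\mathbb C_\lambda}$ states: if $\dot S$ is a name for a subset of $\lambda$ with $\Vdash_{\mathbb C_\lambda}$ "$\dot S$ is a stationary subset of $\lambda$", and $\mathcal O_\alpha\subseteq\mathbb C_\lambda$ ($\alpha<\lambda$) are open dense, then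 there is a $\trianglelefteq$-directed, $\trianglelefteq$-downward closed set $H\subseteq\mathbb C_\lambda$ such that $H\cap\mathcal O_\alpha\ne\emptyset$ for all $\alpha<\lambda$ and $\dot S[H]$ is a stationary subset of $\lambda$. **Proposition.** Assume ${\rm Ax}^+_{\mathbb C_\lambda}$. Then $\mathbb Q^2_\lambda$ is a dense subset of $\mathbb Q^1_\lambda$, i.e. $\mathbb Q^2_\lambda\subseteq\mathbb Q^1_\lambda$ and for every $T\in\mathbb Q^1_\lambda$ there is $T^*\in\mathbb Q^2_\lambda$ with $T^*\subseteq T$. Consequently the forcing notions $\mathbb Q^1_\lambda$ and $\mathbb Q^2_\lambda$ are equivalent, i.e. their complete Boolean algebras of regular open sets are isomorphic. -/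

import Mathlib

open Cardinal

universe u v w

namespace ClubTrees

/-- The set of ordinals below the cardinal `lam`, i.e. the cardinal `lam` viewed as an ordinal. -/
abbrev Idx (lam : Cardinal.{u}) : Type (u + 1) := Set.Iio lam.ord

/-! ### Sequences of length `< lam` with values in `lam` -/

/-- An element of `^{<lam} lam`: a function from an ordinal `len < lam` to `lam`. -/
@[ext]
structure Seq (lam : Cardinal.{u}) : Type (u + 1) where
  /-- the length (domain) of the sequence -/
  len : Idx lam
  /-- the values of the sequence -/
  val : (i : Idx lam) → i < len → Idx lam

namespace Seq

variable {lam : Cardinal.{u}}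

/-- `s ≤ t` means that `s` is an initial segment of `t`; accordingly `s < t` means that `s` is a
proper initial segment of `t`. -/
instance : PartialOrder (Seq lam) where
  le s t := ∃ h : s.len ≤ t.len, ∀ (i : Idx lam) (hi : i < s.len),
    t.val i (lt_of_lt_of_le hi h) = s.val i hi
  le_refl s := ⟨le_refl _, fun _ _ => rfl⟩
  le_trans s t r hst htr := by
    obtain ⟨h1, h2⟩ := hst
    obtain ⟨h3, h4⟩ := htr
    exact ⟨h1.trans h3, fun i hi => (h4 i (lt_of_lt_of_le hi h1)).trans (h2 i hi)⟩
  le_antisymm s t hst hts := by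
    obtain ⟨h1, h2⟩ := hst
    obtain ⟨h3, h4⟩ := hts
    obtain ⟨a, f⟩ := s
    obtain ⟨b, g⟩ := t
    obtain rfl : a = b := le_antisymm h1 h3
    have : f = g := by
      funext i hi
      exact h4 i hi
    rw [this]

/-- The restriction `η ↾ α` of a sequence `η` of length `lam`. -/
def restrict (η : Idx lam → Idx lam) (α : Idx lam) : Seq lam where
  len := α
  val i _ := η i

/-- `t` is the union of the family `c` of sequences: all members of `c` are initial segments of `t`
and their domains cover the domain of `t`. -/
def IsUnion {ι : Type v} (c : ι → Seq lam) (t : Seq lam) : Prop :=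
  (∀ i, c i ≤ t) ∧ ∀ β : Idx lam, β < t.len → ∃ i, β < (c i).len

end Seq

/-! ### Trees -/

section Trees

variable {lam : Cardinal.{u}}

/-- `succ_T(t)`: the set of all `α < lam` such that `t ⌢ ⟨α⟩ ∈ T`. -/
def succSet (T : Set (Seq lam)) (t : Seq lam) : Set (Idx lam) :=
  {α | ∃ s ∈ T, (s.len : Ordinal.{u}) = (t.len : Ordinal.{u}) + 1 ∧ t ≤ s ∧
    ∃ h : t.len < s.len, s.val t.len h = α}

/-- The node `t` splits in `T`, i.e. `|succ_T(t)| > 1`. -/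
def Splits (T : Set (Seq lam)) (t : Seq lam) : Prop := (succSet T t).Nontrivial

/-- `lim_lam(T)`: the set of all `lam`-branches through `T`. -/
def branches (T : Set (Seq lam)) : Set (Idx lam → Idx lam) :=
  {η | ∀ α : Idx lam, Seq.restrict η α ∈ T}

/-- Complete `lam`-trees: sets of sequences in `^{<lam} lam` closed under initial segments, in
which every chain of size `< lam` has an upper bound (hence, taking the empty chain, there is some
node), and in which each node has a proper extension. -/
structure IsCompleteTree (T : Set (Seq lam)) : Prop where
  downClosed : ∀ t ∈ T, ∀ s : Seq lam, s ≤ t → s ∈ T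
  chainBound : ∀ c : Set (Seq lam), c ⊆ T → IsChain (· ≤ ·) c → #c < Cardinal.lift.{u + 1} lam →
    ∃ t ∈ T, ∀ s ∈ c, s ≤ t
  extends_ : ∀ t ∈ T, ∃ s ∈ T, t < s

/-- The family `T^club` of complete `lam`-trees in which every node has exactly one successor or a
club of successors, and above every node there is a splitting node. -/
structure IsClubTree (T : Set (Seq lam)) : Prop where
  complete : IsCompleteTree T
  succ_club : ∀ t ∈ T, (∃ α, succSet T t = {α}) ∨ IsClub (succSet T t)
  splits_above : ∀ t ∈ T, ∃ s ∈ T, t < s ∧ Splits T s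

variable (lam)

/-- The conditions of `Q^1_lam`: trees in `T^club` such that along each `lam`-branch the set of
splitting levels contains a club of `lam`. -/
def Q1 : Set (Set (Seq lam)) :=
  {T | IsClubTree T ∧ ∀ η ∈ branches T,
    ∃ C : Set (Idx lam), IsClub C ∧ C ⊆ {α | Splits T (Seq.restrict η α)}}

/-- The conditions of `Q^2_lam`: trees in `T^club` such that the union of any (non-empty) increasing
sequence `⟨t_i : i < j⟩`, `j < lam`, of splitting nodes is a splitting node of the tree. -/
def Q2 : Set (Set (Seq lam)) :=
  {T | IsClubTree T ∧ ∀ (j : Idx lam) (t : Set.Iio j → Seq lam), Nonempty (Set.Iio j) →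
    StrictMono t → (∀ i, t i ∈ T ∧ Splits T (t i)) → ∃ s ∈ T, Seq.IsUnion t s ∧ Splits T s}

end Trees

/-- The forcing notion with set of conditions `Q` ordered by inverse inclusion:
`T₁ ≤ T₂` (`T₂` is stronger) if and only if `T₂ ⊆ T₁`. -/
abbrev TreeForcing {lam : Cardinal.{u}} (Q : Set (Set (Seq lam))) : Type (u + 1) := (↥Q)ᵒᵈ

/-! ### Equivalence of forcing notions

A forcing notion is a preordered set in which larger conditions are stronger. -/

/-- The regular open subsets of the forcing notion `P`, ordered by inclusion; this is the complete
Boolean algebra associated with `P`. -/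
abbrev RegularOpen (P : Type v) [Preorder P] : Type v :=
  {U : Set P // ∀ p, p ∈ U ↔ ∀ q, p ≤ q → ∃ r, q ≤ r ∧ r ∈ U}

/-- Two forcing notions are equivalent if their associated complete Boolean algebras are
isomorphic. -/
def ForcingEquivalent (P : Type v) (Q : Type w) [Preorder P] [Preorder Q] : Prop :=
  Nonempty (RegularOpen P ≃o RegularOpen Q)

/-! ### The forcing relation for statements about names of subsets of `lam`

Larger conditions are stronger. A statement of the forcing language is represented by the set of
conditions that force it, and this set is computed by the usual recursion. Ordinals of the extension
are those of the ground model, so quantifiers over ordinals range over the ground model. -/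

section Forcing

variable {lam : Cardinal.{u}} {P : Type v} [Preorder P]

/-- A `P`-name for a subset of `lam`: a set of pairs `(α̌, p)` with `α < lam` and `p ∈ P`. Every subset
of `lam` in an extension by `P` has a name of this form. -/
abbrev SubsetName (lam : Cardinal.{u}) (P : Type v) : Type (max (u + 1) v) := Set (Idx lam × P)

/-- The interpretation `S[H]` of a name by a set of conditions `H`. -/
def SubsetName.interp (S : SubsetName lam P) (H : Set P) : Set (Idx lam) :=
  {α | ∃ p ∈ H, (α, p) ∈ S}

namespace Forces

/-- `p` forces `α ∈ X`: the conditions stronger than some `s` with `(α̌, s) ∈ X` are dense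
above `p`. -/
def mem (α : Idx lam) (X : SubsetName lam P) (p : P) : Prop :=
  ∀ q, p ≤ q → ∃ r, q ≤ r ∧ ∃ s, s ≤ r ∧ (α, s) ∈ X

/-- `p` forces `φ ∧ ψ`. -/
def and (φ ψ : P → Prop) (p : P) : Prop := φ p ∧ ψ p

/-- `p` forces `φ → ψ`: every stronger condition that forces `φ` forces `ψ`. -/
def imp (φ ψ : P → Prop) (p : P) : Prop := ∀ q, p ≤ q → φ q → ψ q

/-- `p` forces `∀ x, φ x`. -/
def all {ι : Type w} (φ : ι → P → Prop) (p : P) : Prop := ∀ x, φ x p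

/-- `p` forces `∃ x, φ x`: the conditions that force some instance are dense above `p`. -/
def ex {ι : Type w} (φ : ι → P → Prop) (p : P) : Prop :=
  ∀ q, p ≤ q → ∃ r, q ≤ r ∧ ∃ x, φ x r

/-- `p` forces that `X` is unbounded in `lam`: `∀ α < lam, ∃ β < lam, α < β ∧ β ∈ X`. -/
def unbounded (X : SubsetName lam P) : P → Prop :=
  all fun α : Idx lam => ex fun β : Set.Ioi α => mem β.1 X

/-- `p` forces that `X` is closed in `lam`: for every `0 < δ < lam`, if
`∀ α < δ, ∃ β, α < β < δ ∧ β ∈ X`, then `δ ∈ X`. -/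
def closed (X : SubsetName lam P) : P → Prop :=
  all fun δ : {δ : Idx lam // 0 < (δ : Ordinal.{u})} =>
    imp (all fun α : Set.Iio δ.1 => ex fun β : Set.Ioo α.1 δ.1 => mem β.1 X) (mem δ.1 X)

/-- `p` forces that `X` is a club of `lam`. -/
def club (X : SubsetName lam P) : P → Prop := and (unbounded X) (closed X)

/-- `p` forces that `S` is a stationary subset of `lam`: every club of `lam` in the extension
meets `S`. -/
def stationary (S : SubsetName lam P) : P → Prop :=
  all fun X : SubsetName lam P =>
    imp (club X) (ex fun β : Idx lam => and (mem β X) (mem β S))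

end Forces

end Forcing

/-! ### The axiom -/

/-- The `lam`-Cohen forcing notion: the set `^{<lam} lam` ordered by extension of sequences. -/
abbrev Cohen (lam : Cardinal.{u}) : Type (u + 1) := Seq lam

/-- An open dense subset of a forcing notion in which larger conditions are stronger. -/
def IsOpenDense {P : Type v} [Preorder P] (O : Set P) : Prop :=
  IsUpperSet O ∧ ∀ p, ∃ q ∈ O, p ≤ q

/-- The axiom `Ax^+` for the forcing notion `Cohen lam`: if `S` is a name for a subset of `lam` that
is forced (by every condition) to be stationary, and `O α` (`α < lam`) are open dense sets, then
there is a directed, downward closed set `H` meeting every `O α` such that the interpretation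
`S[H]` is a stationary subset of `lam`. -/
def AxPlus (lam : Cardinal.{u}) : Prop :=
  ∀ S : SubsetName lam (Cohen lam), (∀ p : Cohen lam, Forces.stationary S p) →
    ∀ O : Idx lam → Set (Cohen lam), (∀ α, IsOpenDense (O α)) →
      ∃ H : Set (Cohen lam), DirectedOn (· ≤ ·) H ∧ IsLowerSet H ∧
        (∀ α, (H ∩ O α).Nonempty) ∧ IsStationary (S.interp H)

end ClubTrees

/-!
`Q2 ⊆ Q1`: the splitting levels along a branch are closed by the definition of `Q2`, and they are
cofinal because a splitting node above `η ↾ α` either lies on `η` or leaves `η` at a splitting node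
(`Q2_subset_Q1`).

Density: let `T ∈ Q1`. Every `λ`-sequence `η` can be turned into a branch `follow T η` of `T` by
keeping the values which `T` allows and replacing the other ones. Applied to the Cohen sequence this
gives a generic branch of `T`. If every condition forced the set of non-splitting levels of this
branch to be stationary, then `AxPlus` would give a branch of `T` whose non-splitting levels are
stationary, contradicting `T ∈ Q1`. Hence there are a condition `r` and a name `X` for a club such
that no condition above `r` forces a non-splitting level into `X` (`exists_club_splits`).

Let `A` be the set of conditions `s` above `r` that force their own length into `X`. Nodes of `T`
read from members of `A` split; `A` is closed under unions, since `X` is forced to be closed; and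
`A` is dense above `r`, by a construction of length `ω`. The tree `T' ⊆ T` consists of the nodes
read from those sequences `η` that take an arbitrary allowed value at `i` if `η ↾ i ∈ A`, and run
along a prescribed path to a member of `A` otherwise. Such sequences are determined by the branches
read from them, so the splitting nodes of `T'` are exactly those read from members of `A`, and
closure of `A` under unions says that `T' ∈ Q2` (`thin_mem_Q2`). The members of `A` are Cohen
conditions rather than nodes of `T` because `follow T` may lose information, so that a name in the
Cohen extension need not be decided by nodes of `T`.

Finally, a dense suborder has the same regular open algebra (`forcingEquivalent_of_dense`).
-/

namespace ClubTrees

variable {lam : Cardinal.{u}}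

/-! ### Sequences and their restrictions -/

theorem exists_succ (h : ℵ₀ ≤ lam) (i : Idx lam) :
    ∃ j : Idx lam, (j : Ordinal.{u}) = (i : Ordinal.{u}) + 1 :=
  ⟨⟨i + 1, (isSuccLimit_ord h).succ_lt i.2⟩, rfl⟩

theorem lt_succ_iff {i j k : Idx lam} (hj : (j : Ordinal.{u}) = (i : Ordinal.{u}) + 1) :
    k < j ↔ k ≤ i := by
  rw [← Subtype.coe_lt_coe, hj, ← Subtype.coe_le_coe, Order.lt_add_one_iff]

theorem mk_Iio_idx_lt (i : Idx lam) : #(Set.Iio i) < Cardinal.lift.{u + 1} lam := by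
  have h := mk_Iio_lt (α := Idx lam) i (by
    rw [Cardinal.mk_Iio_ordinal, card_ord, Ordinal.type_lt_Iio, lift_ord])
  rwa [Cardinal.mk_Iio_ordinal, card_ord] at h

namespace Seq

/-- An extension of a sequence of length `< lam` to a sequence of length `lam`; the values at
indices outside of the domain are arbitrary. -/
noncomputable def toFun (s : Seq lam) (i : Idx lam) : Idx lam :=
  open Classical in if h : i < s.len then s.val i h else i

@[simp] theorem restrict_len (η : Idx lam → Idx lam) (α : Idx lam) : (restrict η α).len = α := rfl

theorem toFun_of_lt {s : Seq lam} {i : Idx lam} (h : i < s.len) : s.toFun i = s.val i h := by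
  simp [toFun, h]

theorem toFun_restrict {η : Idx lam → Idx lam} {α i : Idx lam} (h : i < α) :
    (restrict η α).toFun i = η i :=
  toFun_of_lt (s := restrict η α) h

theorem restrict_congr {η η' : Idx lam → Idx lam} {α : Idx lam} (h : ∀ i < α, η i = η' i) :
    restrict η α = restrict η' α := by
  have : (fun (i : Idx lam) (_ : i < α) => η i) = fun i _ => η' i := by
    funext i hi
    exact h i hi
  simp only [restrict, this]

@[simp] theorem restrict_toFun (s : Seq lam) : restrict s.toFun s.len = s := by
  obtain ⟨a, f⟩ := s
  have : (fun (i : Idx lam) (_ : i < a) => toFun ⟨a, f⟩ i) = f := by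
    funext i hi
    exact toFun_of_lt (s := ⟨a, f⟩) hi
  simp only [restrict, this]

theorem le_iff {s t : Seq lam} : s ≤ t ↔ s.len ≤ t.len ∧ ∀ i < s.len, t.toFun i = s.toFun i := by
  constructor
  · rintro ⟨h, h'⟩
    refine ⟨h, fun i hi => ?_⟩
    rw [toFun_of_lt hi, toFun_of_lt (hi.trans_le h), h']
  · rintro ⟨h, h'⟩
    refine ⟨h, fun i hi => ?_⟩
    have := h' i hi
    rwa [toFun_of_lt hi, toFun_of_lt (hi.trans_le h)] at this

theorem restrict_le_restrict {η η' : Idx lam → Idx lam} {α β : Idx lam} :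
    restrict η α ≤ restrict η' β ↔ α ≤ β ∧ ∀ i < α, η' i = η i :=
  Iff.rfl.trans ⟨fun ⟨h, h'⟩ => ⟨h, h'⟩, fun ⟨h, h'⟩ => ⟨h, h'⟩⟩

theorem restrict_mono (η : Idx lam → Idx lam) : Monotone (restrict η) :=
  fun _ _ h => restrict_le_restrict.2 ⟨h, fun _ _ => rfl⟩

theorem restrict_inj {η η' : Idx lam → Idx lam} {α : Idx lam} :
    restrict η α = restrict η' α ↔ ∀ i < α, η i = η' i :=
  ⟨fun h => fun i hi => (restrict_le_restrict.1 h.ge).2 i hi, restrict_congr⟩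

theorem le_restrict_iff {s : Seq lam} {η : Idx lam → Idx lam} {α : Idx lam} :
    s ≤ restrict η α ↔ s.len ≤ α ∧ s = restrict η s.len := by
  rw [← restrict_toFun s, restrict_le_restrict, restrict_len, restrict_inj]
  exact and_congr Iff.rfl ⟨fun h i hi => (h i hi).symm, fun h i hi => (h i hi).symm⟩

theorem restrict_le_iff {s : Seq lam} {η : Idx lam → Idx lam} {α : Idx lam} :
    restrict η α ≤ s ↔ α ≤ s.len ∧ ∀ i < α, s.toFun i = η i := by
  conv_lhs => rw [← restrict_toFun s, restrict_le_restrict]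

theorem restrict_toFun_le {s : Seq lam} {α : Idx lam} (h : α ≤ s.len) :
    restrict s.toFun α ≤ s :=
  restrict_le_iff.2 ⟨h, fun _ _ => rfl⟩

theorem len_mono : Monotone (len : Seq lam → Idx lam) := fun _ _ h => h.1

theorem eq_of_le_of_len_le {s t : Seq lam} (h : s ≤ t) (h' : t.len ≤ s.len) : s = t := by
  rw [← restrict_toFun t] at h ⊢
  rw [le_restrict_iff] at h
  rw [h.2, le_antisymm h.1 h']

theorem len_strictMono : StrictMono (len : Seq lam → Idx lam) := fun _ _ h =>
  lt_of_not_ge fun h' => h.ne (eq_of_le_of_len_le h.le h')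

/-- A chain of sequences whose lengths are bounded below `lam` has a union. -/
theorem exists_isUnion {ι : Type v} (c : ι → Seq lam) (hc : ∀ i j, c i ≤ c j ∨ c j ≤ c i)
    (δ : Idx lam) (hδ : ∀ i, (c i).len ≤ δ) : ∃ t, IsUnion c t := by
  classical
  let η : Idx lam → Idx lam := fun β => if h : ∃ i, β < (c i).len then (c h.choose).toFun β else β
  have hη : ∀ i, ∀ β < (c i).len, η β = (c i).toFun β := by
    intro i β hβ
    have h : ∃ i, β < (c i).len := ⟨i, hβ⟩
    have e : η β = (c h.choose).toFun β := dif_pos h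
    rw [e]
    rcases hc i h.choose with h' | h'
    · exact (le_iff.1 h').2 β hβ
    · exact ((le_iff.1 h').2 β h.choose_spec).symm
  have hmin := WellFounded.has_min (wellFounded_lt (α := Idx lam)) {α | ∀ i, (c i).len ≤ α} ⟨δ, hδ⟩
  obtain ⟨α, hα, hmin⟩ := hmin
  refine ⟨restrict η α, fun i => le_restrict_iff.2 ⟨hα i, ?_⟩, fun β hβ => ?_⟩
  · conv_lhs => rw [← restrict_toFun (c i)]
    exact restrict_congr fun β hβ => (hη i β hβ).symm
  · by_contra! h
    exact hmin β h hβ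

theorem IsUnion.le {ι : Type v} {c : ι → Seq lam} {t u : Seq lam} (h : IsUnion c t)
    (hu : ∀ i, c i ≤ u) : t ≤ u := by
  refine le_iff.2 ⟨le_of_not_gt fun h' => ?_, fun β hβ => ?_⟩
  · obtain ⟨i, hi⟩ := h.2 _ h'
    exact (hi.trans_le (len_mono (hu i))).false
  · obtain ⟨i, hi⟩ := h.2 _ hβ
    rw [(le_iff.1 (hu i)).2 β hi, (le_iff.1 (h.1 i)).2 β hi]

theorem exists_le_len (s : Seq lam) (α : Idx lam) : ∃ t, s ≤ t ∧ α ≤ t.len :=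
  ⟨restrict s.toFun (max s.len α),
    le_restrict_iff.2 ⟨le_max_left _ _, (restrict_toFun s).symm⟩, le_max_right _ _⟩

end Seq

open ClubTrees.Seq

/-! ### Trees and their branches -/

variable {T : Set (Seq lam)}

theorem mem_succSet_restrict (hinf : ℵ₀ ≤ lam) (hT : ∀ t ∈ T, ∀ s : Seq lam, s ≤ t → s ∈ T)
    {η : Idx lam → Idx lam} {α β : Idx lam} (hαβ : α < β) (h : restrict η β ∈ T) :
    η α ∈ succSet T (restrict η α) := by
  obtain ⟨j, hj⟩ := exists_succ hinf α
  have hα : α < j := (lt_succ_iff hj).2 le_rfl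
  have hjβ : j ≤ β := le_of_not_gt fun h => ((lt_succ_iff hj).1 h).not_gt hαβ
  exact ⟨restrict η j, hT _ h _ (restrict_mono η hjβ), hj, restrict_mono η hα.le, hα, rfl⟩

theorem restrict_mem_of_mem_succSet {η : Idx lam → Idx lam} {α j : Idx lam}
    (hj : (j : Ordinal.{u}) = (α : Ordinal.{u}) + 1) (h : η α ∈ succSet T (restrict η α)) :
    restrict η j ∈ T := by
  obtain ⟨s, hs, hlen, hle, hlt, hval⟩ := h
  have hl : s.len = j := Subtype.ext (hlen.trans hj.symm)
  rw [← restrict_toFun s, hl] at hs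
  convert hs using 1
  refine restrict_congr fun i hi => ?_
  rcases ((lt_succ_iff hj).1 hi).lt_or_eq with hi | rfl
  · exact ((restrict_le_iff.1 hle).2 i hi).symm
  · exact hval.symm.trans (toFun_of_lt hlt).symm

theorem succSet_nonempty (hinf : ℵ₀ ≤ lam) (hT : IsCompleteTree T) {t : Seq lam} (ht : t ∈ T) :
    (succSet T t).Nonempty := by
  obtain ⟨s, hs, hts⟩ := hT.extends_ t ht
  rw [← restrict_toFun s] at hs
  have := mem_succSet_restrict hinf hT.downClosed (len_strictMono hts) hs
  rw [← restrict_toFun s] at hts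
  rw [← (le_restrict_iff.1 hts.le).2] at this
  exact ⟨_, this⟩

theorem isClub_succSet_of_splits (hT : IsClubTree T) {t : Seq lam} (ht : t ∈ T)
    (hs : Splits T t) : IsClub (succSet T t) := by
  rcases hT.succ_club t ht with ⟨a, ha⟩ | h
  · rw [Splits, ha] at hs
    exact absurd hs Set.not_nontrivial_singleton
  · exact h

/-- A sequence of length `lam` all of whose values are successors allowed by `T` is a branch. -/
theorem mem_branches_of_succSet (hinf : ℵ₀ ≤ lam) (hT : IsCompleteTree T)
    {η : Idx lam → Idx lam}
    (h : ∀ α, restrict η α ∈ T → η α ∈ succSet T (restrict η α)) : η ∈ branches T := by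
  intro α
  induction α using WellFoundedLT.induction with
  | ind α ih =>
  by_cases hα : ∃ i : Idx lam, (α : Ordinal.{u}) = i + 1
  · obtain ⟨i, hi⟩ := hα
    exact restrict_mem_of_mem_succSet hi (h i (ih i ((lt_succ_iff hi).2 le_rfl)))
  · obtain ⟨t, ht, hle⟩ := hT.chainBound (Set.range fun i : Set.Iio α => restrict η i.1)
      (by rintro _ ⟨i, rfl⟩; exact ih i.1 i.2)
      (by
        rintro _ ⟨i, rfl⟩ _ ⟨j, rfl⟩ _
        exact (le_total i.1 j.1).imp (fun h => restrict_mono _ h) fun h => restrict_mono _ h)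
      (mk_range_le.trans_lt (mk_Iio_idx_lt α))
    have key : ∀ i < α, i < t.len ∧ t.toFun i = η i := by
      intro i hi
      obtain ⟨j, hj⟩ := exists_succ hinf i
      have hij : i < j := (lt_succ_iff hj).2 le_rfl
      have hjα : j < α := by
        refine lt_of_le_of_ne (le_of_not_gt fun h => ?_) fun h => hα ⟨i, h ▸ hj⟩
        exact ((lt_succ_iff hj).1 h).not_gt hi
      have := restrict_le_iff.1 (hle _ ⟨⟨j, hjα⟩, rfl⟩)
      exact ⟨hij.trans_le this.1, this.2 i hij⟩
    exact hT.downClosed t ht _ (restrict_le_iff.2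
      ⟨le_of_not_gt fun h => (key _ h).1.false, fun i hi => (key i hi).2⟩)

/-- The union of a chain of fewer than `lam` nodes of a complete tree is a node. -/
theorem IsCompleteTree.exists_isUnion (hT : IsCompleteTree T) {j : Idx lam}
    (t : Set.Iio j → Seq lam) (ht : Monotone t) (h : ∀ i, t i ∈ T) :
    ∃ s ∈ T, IsUnion t s := by
  have hc : ∀ i k, t i ≤ t k ∨ t k ≤ t i := fun i k => (le_total i k).imp (@ht _ _) (@ht _ _)
  obtain ⟨u, hu, hle⟩ := hT.chainBound (Set.range t)
    (by rintro _ ⟨i, rfl⟩; exact h i) (by rintro _ ⟨i, rfl⟩ _ ⟨k, rfl⟩ _; exact hc i k)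
    (mk_range_le.trans_lt (mk_Iio_idx_lt j))
  obtain ⟨s, hs⟩ := Seq.exists_isUnion t hc u.len fun i => len_mono (hle _ ⟨i, rfl⟩)
  exact ⟨s, hT.downClosed u hu s (hs.le fun i => hle _ ⟨i, rfl⟩), hs⟩

/-! ### `Q2` is contained in `Q1` -/

/-- The splitting levels along a branch of a club tree are cofinal: a splitting node above
`η ↾ α` either lies on `η`, or it branches off `η` at a splitting node. -/
theorem exists_splits_of_mem_branches (hinf : ℵ₀ ≤ lam) (hT : IsClubTree T)
    {η : Idx lam → Idx lam} (hη : η ∈ branches T) (α : Idx lam) :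
    ∃ β, α ≤ β ∧ Splits T (restrict η β) := by
  obtain ⟨s, hs, hlt, hsplit⟩ := hT.splits_above _ (hη α)
  by_cases h : ∃ β < s.len, η β ≠ s.toFun β
  · obtain ⟨β, ⟨hβ, hne⟩, hmin⟩ := WellFounded.has_min (wellFounded_lt (α := Idx lam))
      {β | β < s.len ∧ η β ≠ s.toFun β} h
    have heq : ∀ i < β, η i = s.toFun i := fun i hi => by
      by_contra h'
      exact hmin i ⟨hi.trans hβ, h'⟩ hi
    refine ⟨β, le_of_not_gt fun h' => hne ((restrict_le_iff.1 hlt.le).2 β h').symm,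
      η β, ?_, s.toFun β, ?_, hne⟩
    · obtain ⟨j, hj⟩ := exists_succ hinf β
      exact mem_succSet_restrict hinf hT.complete.downClosed ((lt_succ_iff hj).2 le_rfl) (hη j)
    · rw [restrict_congr heq]
      exact mem_succSet_restrict hinf hT.complete.downClosed hβ (by rwa [restrict_toFun])
  · push Not at h
    refine ⟨s.len, len_mono hlt.le, ?_⟩
    rwa [restrict_congr h, restrict_toFun]

theorem Q2_subset_Q1 (hinf : ℵ₀ ≤ lam) : Q2 lam ⊆ Q1 lam := by
  rintro T ⟨hT, hunion⟩
  refine ⟨hT, fun η hη => ⟨{α | Splits T (restrict η α)}, ⟨?_, fun α => ?_⟩, subset_rfl⟩⟩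
  · intro d hd hne _ δ hδ
    by_cases hδd : δ ∈ d
    · exact hd hδd
    have hdδ : ∀ x ∈ d, x < δ := fun x hx => lt_of_le_of_ne (hδ.1 hx) fun h => hδd (h ▸ hx)
    -- Enumerate `d` increasingly; the order type is at most `δ`.
    have hle : Ordinal.type (α := d) (· < ·) ≤ Ordinal.type (α := Set.Iio δ) (· < ·) :=
      Ordinal.type_le_iff'.2 ⟨⟨⟨fun x => ⟨x.1, hdδ x.1 x.2⟩, fun x y h =>
        Subtype.ext (Subtype.mk.inj h)⟩, Iff.rfl⟩⟩
    rw [Ordinal.type_Iio_lt] at hle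
    obtain ⟨j, hj⟩ := Ordinal.typein_surj (α := Idx lam) (· < ·)
      (hle.trans_lt (Ordinal.typein_lt_type _ δ))
    rw [← Ordinal.type_Iio_lt] at hj
    obtain ⟨e⟩ := Ordinal.type_eq.1 hj
    obtain ⟨s, -, hs, hsplit⟩ := hunion j (fun i => restrict η (e i).1)
      (let ⟨x, hx⟩ := hne; ⟨e.symm ⟨x, hx⟩⟩)
      (fun i k hik => lt_of_le_of_ne (restrict_mono η (e.map_rel_iff.2 hik).le) fun h =>
        (e.map_rel_iff.2 hik).ne (Subtype.ext (congrArg len h)))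
      (fun i => ⟨hη _, hd (e i).2⟩)
    have hsδ : s ≤ restrict η δ := hs.le fun i => restrict_mono η (hδ.1 (e i).2)
    have hlen : δ ≤ s.len := hδ.2 fun x hx => by
      have := len_mono (hs.1 (e.symm ⟨x, hx⟩))
      simpa using this
    have := eq_of_le_of_len_le hsδ hlen
    rwa [this] at hsplit
  · obtain ⟨β, h, h'⟩ := exists_splits_of_mem_branches hinf hT hη α
    exact ⟨β, h', h⟩

/-! ### Dense suborders -/

/-- A forcing notion is equivalent to any of its dense suborders. -/
theorem forcingEquivalent_of_dense {P : Type v} {Q : Type w} [Preorder P] [Preorder Q]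
    (i : Q → P) (hi : ∀ a b, i a ≤ i b ↔ a ≤ b) (hd : ∀ p, ∃ q, p ≤ i q) :
    ForcingEquivalent P Q := by
  have up : ∀ (U : RegularOpen P) {p q : P}, p ≤ q → p ∈ U.1 → q ∈ U.1 :=
    fun U p q hpq hp => (U.2 q).2 fun r hr => (U.2 p).1 hp r (hpq.trans hr)
  let f : RegularOpen P → RegularOpen Q := fun U => ⟨i ⁻¹' U.1, fun q => by
    refine ⟨fun h a ha => ⟨a, le_rfl, up U ((hi _ _).2 ha) h⟩, fun h => (U.2 _).2 fun p hp => ?_⟩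
    obtain ⟨a, ha⟩ := hd p
    obtain ⟨r, har, hr⟩ := h a ((hi _ _).1 (hp.trans ha))
    exact ⟨i r, ha.trans ((hi _ _).2 har), hr⟩⟩
  let g : RegularOpen Q → RegularOpen P := fun V =>
    ⟨{p | ∀ p', p ≤ p' → ∃ r, p' ≤ i r ∧ r ∈ V.1}, fun p => by
    refine ⟨fun h q hq => ⟨q, le_rfl, fun p' hp' => h p' (hq.trans hp')⟩, fun h p' hp' => ?_⟩
    obtain ⟨r, hr, hr'⟩ := h p' hp'
    obtain ⟨a, ha, ha'⟩ := hr' r le_rfl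
    exact ⟨a, hr.trans ha, ha'⟩⟩
  have hfg : ∀ V, f (g V) = V := fun V => Subtype.ext <| Set.ext fun q => by
    rw [V.2 q]
    constructor
    · intro h a ha
      obtain ⟨r, hr, hr'⟩ := h (i a) ((hi _ _).2 ha)
      exact ⟨r, (hi _ _).1 hr, hr'⟩
    · intro h p' hp'
      obtain ⟨a, ha⟩ := hd p'
      obtain ⟨r, hr, hr'⟩ := h a ((hi _ _).1 (hp'.trans ha))
      exact ⟨r, ha.trans ((hi _ _).2 hr), hr'⟩
  have hgf : ∀ U, g (f U) = U := fun U => Subtype.ext <| Set.ext fun p => by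
    rw [U.2 p]
    constructor
    · intro h a ha
      obtain ⟨r, hr, hr'⟩ := h a ha
      exact ⟨i r, hr, hr'⟩
    · intro h a ha
      obtain ⟨r, hr, hr'⟩ := h a ha
      obtain ⟨b, hb⟩ := hd r
      exact ⟨b, hr.trans hb, up U hb hr'⟩
  have hf : Monotone f := fun U V h q hq => h hq
  have hg : Monotone g := fun U V h p hp p' hp' =>
    let ⟨r, hr, hr'⟩ := hp p' hp'
    ⟨r, hr, h hr'⟩
  exact ⟨{ toFun := f, invFun := g, left_inv := hgf, right_inv := hfg
           map_rel_iff' := fun {U V} => ⟨fun h => by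
             have : g (f U) ≤ g (f V) := hg h
             rwa [hgf, hgf] at this, fun h => hf h⟩ }⟩

/-! ### The forcing relation -/

namespace Forces

variable {P : Type v} [Preorder P]

theorem mem_mono {α : Idx lam} {X : SubsetName lam P} {p q : P} (hpq : p ≤ q) (h : mem α X p) :
    mem α X q :=
  fun r hr => h r (hpq.trans hr)

theorem club_mono {X : SubsetName lam P} {p q : P} (hpq : p ≤ q) (h : club X p) : club X q :=
  ⟨fun α r hr => h.1 α r (hpq.trans hr), fun δ r hr => h.2 δ r (hpq.trans hr)⟩

end Forces

/-- The Cohen conditions above `r` that force their own length to belong to the name `X`. -/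
def decidingConditions (X : SubsetName lam (Cohen lam)) (r : Cohen lam) : Set (Seq lam) :=
  {s | r ≤ s ∧ Forces.mem s.len X s}

section decidingConditions

variable {X : SubsetName lam (Cohen lam)} {r : Cohen lam}

/-- If `s` forces cofinally many ordinals below its length into the name `X` of a club, then `s`
forces its own length into `X`. -/
theorem mem_decidingConditions_of_cofinal (hX : Forces.club X r) {s : Seq lam} (hrs : r ≤ s)
    (h0 : 0 < (s.len : Ordinal.{u}))
    (h : ∀ α < s.len, ∃ β, α < β ∧ β < s.len ∧ Forces.mem β X s) :
    s ∈ decidingConditions X r := by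
  refine ⟨hrs, hX.2 ⟨s.len, h0⟩ s hrs fun α q hq => ⟨q, le_rfl, ?_⟩⟩
  obtain ⟨β, h1, h2, h3⟩ := h α.1 α.2
  exact ⟨⟨β, h1, h2⟩, Forces.mem_mono hq h3⟩

theorem isUnion_mem_decidingConditions (hX : Forces.club X r) {ι : Type w} [Nonempty ι]
    {c : ι → Seq lam} (hA : ∀ i, c i ∈ decidingConditions X r)
    {s : Seq lam} (hs : IsUnion c s) : s ∈ decidingConditions X r := by
  by_cases hmem : ∃ i, c i = s
  · obtain ⟨i, rfl⟩ := hmem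
    exact hA i
  push Not at hmem
  have hlt : ∀ i, (c i).len < s.len := fun i => len_strictMono ((hs.1 i).lt_of_ne (hmem i))
  obtain ⟨i₀⟩ := ‹Nonempty ι›
  refine mem_decidingConditions_of_cofinal hX ((hA i₀).1.trans (hs.1 i₀))
    (pos_of_gt (Subtype.coe_lt_coe.2 (hlt i₀))) fun α hα => ?_
  obtain ⟨i, hi⟩ := hs.2 α hα
  exact ⟨_, hi, hlt i, Forces.mem_mono (hs.1 i) (hA i).2⟩

/-- The deciding conditions are dense above `r`: alternate between forcing a larger ordinal
into `X` and lengthening the condition beyond that ordinal, and take the union after `ω` steps. -/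
theorem exists_le_mem_decidingConditions (hreg : lam.IsRegular) (hunc : ℵ₀ < lam)
    (hX : Forces.club X r) {s : Seq lam} (hrs : r ≤ s) :
    ∃ a ∈ decidingConditions X r, s ≤ a := by
  have step : ∀ t : {t : Seq lam // r ≤ t}, ∃ t' : {t : Seq lam // r ≤ t}, t.1 ≤ t'.1 ∧
      ∃ β, t.1.len < β ∧ β < t'.1.len ∧ Forces.mem β X t'.1 := by
    rintro ⟨t, ht⟩
    obtain ⟨t', htt', ⟨β, hβ⟩, hmem⟩ := hX.1 t.len t ht
    obtain ⟨γ, hγ⟩ := exists_succ hreg.aleph0_le β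
    obtain ⟨t'', h1, h2⟩ := exists_le_len t' γ
    exact ⟨⟨t'', ht.trans (htt'.trans h1)⟩, htt'.trans h1, β, hβ,
      ((lt_succ_iff hγ).2 le_rfl).trans_le h2, Forces.mem_mono h1 hmem⟩
  choose F hF G hG1 hG2 hG3 using step
  let c : ℕ → {t : Seq lam // r ≤ t} := fun n => F^[n] ⟨s, hrs⟩
  have hc : ∀ n, c (n + 1) = F (c n) := fun n => Function.iterate_succ_apply' F n _
  have hmono : Monotone fun n => (c n).1 := monotone_nat_of_le_succ fun n => by
    rw [hc]
    exact hF _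
  obtain ⟨δ, hδ⟩ : ∃ δ : Idx lam, ∀ n, (c n).1.len ≤ δ := by
    refine ⟨⟨⨆ n, ((c n).1.len : Ordinal.{u}), ?_⟩, fun n => ?_⟩
    · refine Ordinal.lift_iSup_lt_of_lt_cof ?_ fun n => (c n).1.len.2
      simpa [hreg.cof_ord] using hunc
    · exact Subtype.coe_le_coe.1 (Ordinal.le_iSup (fun n => ((c n).1.len : Ordinal.{u})) n)
  obtain ⟨a, ha⟩ := Seq.exists_isUnion (fun n => (c n).1)
    (fun i j => (le_total i j).imp (@hmono _ _) (@hmono _ _)) δ hδ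
  have hlt : ∀ n, (c n).1.len < G (c n) ∧ G (c n) < a.len ∧ Forces.mem (G (c n)) X a := fun n => by
    have h1 := ha.1 (n + 1)
    simp only [hc] at h1
    exact ⟨hG1 _, (hG2 _).trans_le (len_mono h1), Forces.mem_mono h1 (hG3 _)⟩
  refine ⟨a, mem_decidingConditions_of_cofinal hX (hrs.trans (ha.1 0))
    (pos_of_gt (Subtype.coe_lt_coe.2 (hlt 0).2.1)) fun α hα => ?_, ha.1 0⟩
  obtain ⟨n, hn⟩ := ha.2 α hα
  exact ⟨_, hn.trans (hlt n).1, (hlt n).2⟩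

end decidingConditions

/-! ### Reading a branch of a tree from a Cohen sequence -/

section follow

variable (T : Set (Seq lam))

open Classical in
/-- A choice of a successor of the node `t` of `T`: the ordinal `a` if this is a successor of `t`,
and some fixed successor otherwise. -/
noncomputable def nextValue (t : Seq lam) (a : Idx lam) : Idx lam :=
  if a ∈ succSet T t then a else if h : (succSet T t).Nonempty then h.choose else a

/-- The branch of `T` read from `η`: its value at `i` is `η i` if this is allowed by `T`, and some
allowed value otherwise. -/
noncomputable def follow (η : Idx lam → Idx lam) : Idx lam → Idx lam :=
  (wellFounded_lt (α := Idx lam)).fix fun i F => nextValue T ⟨i, F⟩ (η i)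

variable {T}

theorem nextValue_of_mem {t : Seq lam} {a : Idx lam} (h : a ∈ succSet T t) :
    nextValue T t a = a := if_pos h

theorem nextValue_mem {t : Seq lam} (h : (succSet T t).Nonempty) (a : Idx lam) :
    nextValue T t a ∈ succSet T t := by
  unfold nextValue
  split_ifs with h'
  · exact h'
  · exact h.choose_spec

theorem follow_apply (η : Idx lam → Idx lam) (i : Idx lam) :
    follow T η i = nextValue T (restrict (follow T η) i) (η i) :=
  WellFounded.fix_eq _ _ _

theorem follow_of_mem {η : Idx lam → Idx lam} {i : Idx lam}
    (h : η i ∈ succSet T (restrict (follow T η) i)) : follow T η i = η i := by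
  rw [follow_apply, nextValue_of_mem h]

theorem restrict_follow_congr {η η' : Idx lam → Idx lam} {α : Idx lam}
    (h : ∀ i < α, η i = η' i) : restrict (follow T η) α = restrict (follow T η') α := by
  refine restrict_congr fun i => ?_
  induction i using WellFoundedLT.induction with
  | ind i ih =>
    intro hi
    rw [follow_apply, follow_apply, h i hi,
      restrict_congr fun k hk => ih k hk (hk.trans hi)]

theorem follow_mem_branches (hinf : ℵ₀ ≤ lam) (hT : IsCompleteTree T) (η : Idx lam → Idx lam) :
    follow T η ∈ branches T :=
  mem_branches_of_succSet hinf hT fun α h => by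
    rw [follow_apply]
    exact nextValue_mem (succSet_nonempty hinf hT h) _

end follow

/-! ### A club disjoint from the non-splitting levels of the generic branch -/

/-- The name for the set of those levels at which the branch of `T` read from the Cohen sequence
does not split. -/
def nonsplitName (T : Set (Seq lam)) : SubsetName lam (Cohen lam) :=
  {x | x.2.len = x.1 ∧ ¬ Splits T (restrict (follow T x.2.toFun) x.1)}

/-- For `T ∈ Q1` the axiom implies that the non-splitting levels of the generic branch are not
forced to be stationary: otherwise they would be stationary along some branch of `T`. -/
theorem exists_not_forces_stationary (hinf : ℵ₀ ≤ lam) (hAx : AxPlus lam) {T : Set (Seq lam)}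
    (hT : T ∈ Q1 lam) : ∃ p, ¬ Forces.stationary (nonsplitName T) p := by
  by_contra! h
  obtain ⟨H, hdir, -, hmeet, hstat⟩ := hAx _ h (fun α => {s | α < s.len}) fun α => by
    refine ⟨fun s t hst hs => hs.trans_le (len_mono hst), fun p => ?_⟩
    obtain ⟨j, hj⟩ := exists_succ hinf α
    obtain ⟨t, ht, ht'⟩ := exists_le_len p j
    exact ⟨t, ((lt_succ_iff hj).2 le_rfl).trans_le ht', ht⟩
  choose s hsH hs using hmeet
  let η : Idx lam → Idx lam := fun i => (s i).toFun i
  have hη : ∀ p ∈ H, ∀ i < p.len, p.toFun i = η i := fun p hp i hi => by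
    obtain ⟨t, -, hpt, hst⟩ := hdir p hp (s i) (hsH i)
    rw [← (le_iff.1 hpt).2 i hi]
    exact (le_iff.1 hst).2 i (hs i)
  obtain ⟨C, hC, hsplit⟩ := hT.2 _ (follow_mem_branches hinf hT.1.complete η)
  obtain ⟨α, ⟨p, hp, hlen, hns⟩, hα⟩ := hstat hC
  dsimp only at hlen hns
  subst hlen
  rw [restrict_follow_congr (hη p hp)] at hns
  exact hns (hsplit hα)

/-- Below some condition `r` there is a name for a club such that whenever a condition above `r`
forces its own length into that club, the node of `T` read from this condition splits. -/
theorem exists_club_splits (hinf : ℵ₀ ≤ lam) (hAx : AxPlus lam) {T : Set (Seq lam)}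
    (hT : T ∈ Q1 lam) : ∃ (X : SubsetName lam (Cohen lam)) (r : Cohen lam), Forces.club X r ∧
      ∀ s ∈ decidingConditions X r, Splits T (restrict (follow T s.toFun) s.len) := by
  obtain ⟨p, hp⟩ := exists_not_forces_stationary hinf hAx hT
  simp only [Forces.stationary, Forces.all, Forces.imp, Forces.ex] at hp
  push Not at hp
  obtain ⟨X, q, -, hX, r, hqr, hr⟩ := hp
  refine ⟨X, r, Forces.club_mono hqr hX, fun s hs => ?_⟩
  by_contra hns
  exact hr s hs.1 s.len ⟨hs.2, fun t ht => ⟨t, le_rfl, s, ht, rfl, hns⟩⟩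

/-! ### Thinning out a tree -/

section thin

variable (T A : Set (Seq lam)) (f : Seq lam → Idx lam)

/-- The sequence `η` obeys the thinning rule at `i`: if `η ↾ i` is in `A`, then `η i` may be any
successor of the node of `T` read from `η ↾ i`; otherwise `η i` is prescribed by `f`. -/
def Obeys (η : Idx lam → Idx lam) (i : Idx lam) : Prop :=
  (restrict η i ∈ A → η i ∈ succSet T (restrict (follow T η) i)) ∧
    (restrict η i ∉ A → η i = f (restrict η i))

/-- The subtree of `T` of all nodes read from sequences that obey the thinning rule. -/
def thin : Set (Seq lam) :=
  {t | ∃ η : Idx lam → Idx lam, t = restrict (follow T η) t.len ∧ ∀ i < t.len, Obeys T A f η i}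

variable {T A f}

theorem restrict_mem_thin {η : Idx lam → Idx lam} {α : Idx lam}
    (h : ∀ i < α, Obeys T A f η i) : restrict (follow T η) α ∈ thin T A f :=
  ⟨η, rfl, h⟩

theorem obeys_congr {η η' : Idx lam → Idx lam} {α i : Idx lam} (h : ∀ i < α, η i = η' i)
    (hi : i < α) (ho : Obeys T A f η i) : Obeys T A f η' i := by
  have h' : ∀ k < i, η k = η' k := fun k hk => h k (hk.trans hi)
  unfold Obeys
  rwa [← restrict_follow_congr h', ← restrict_congr h', ← h i hi]

/-- On sequences that obey the thinning rule, no information is lost when reading a node of `T`. -/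
theorem eq_of_restrict_follow_eq {η η' : Idx lam → Idx lam} {α : Idx lam}
    (h : ∀ i < α, Obeys T A f η i) (h' : ∀ i < α, Obeys T A f η' i)
    (heq : restrict (follow T η) α = restrict (follow T η') α) : ∀ i < α, η i = η' i := by
  intro i
  induction i using WellFoundedLT.induction with
  | ind i ih =>
    intro hi
    have hr : restrict η i = restrict η' i := restrict_congr fun k hk => ih k hk (hk.trans hi)
    by_cases hA : restrict η i ∈ A
    · rw [← follow_of_mem ((h i hi).1 hA), ← follow_of_mem ((h' i hi).1 (hr ▸ hA))]
      exact restrict_inj.1 heq i hi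
    · rw [(h i hi).2 hA, (h' i hi).2 (hr ▸ hA), hr]

theorem eq_of_restrict_follow_le {η η' : Idx lam → Idx lam} {α α' : Idx lam}
    (h : ∀ i < α, Obeys T A f η i) (h' : ∀ i < α', Obeys T A f η' i)
    (hle : restrict (follow T η) α ≤ restrict (follow T η') α') :
    restrict η α ≤ restrict η' α' := by
  obtain ⟨hα, heq⟩ := le_restrict_iff.1 hle
  refine restrict_le_restrict.2 ⟨hα, fun i hi => ?_⟩
  exact (eq_of_restrict_follow_eq h (fun i hi => h' i (hi.trans_le hα)) heq i hi).symm

theorem thin_subset (hinf : ℵ₀ ≤ lam) (hT : IsCompleteTree T) : thin T A f ⊆ T := by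
  rintro t ⟨η, ht, -⟩
  rw [ht]
  exact follow_mem_branches hinf hT η _

theorem thin_downClosed : ∀ t ∈ thin T A f, ∀ s : Seq lam, s ≤ t → s ∈ thin T A f := by
  rintro t ⟨η, ht, ho⟩ s hs
  rw [ht] at hs
  obtain ⟨hlen, hs⟩ := le_restrict_iff.1 hs
  exact ⟨η, hs, fun i hi => ho i (hi.trans_le hlen)⟩

theorem succSet_mono {T' : Set (Seq lam)} (h : T' ⊆ T) (t : Seq lam) :
    succSet T' t ⊆ succSet T t :=
  fun _ ⟨s, hs, h'⟩ => ⟨s, h hs, h'⟩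

/-- If `η` obeys the thinning rule below `α`, then prescribing an admissible value at `α` yields a
successor of the corresponding node of the thinned tree. -/
theorem follow_update_mem_succSet_thin (hinf : ℵ₀ ≤ lam) {η : Idx lam → Idx lam} {α : Idx lam}
    (h : ∀ i < α, Obeys T A f η i) {a : Idx lam}
    (hA : restrict η α ∈ A → a ∈ succSet T (restrict (follow T η) α))
    (hA' : restrict η α ∉ A → a = f (restrict η α)) :
    follow T (Function.update η α a) α ∈ succSet (thin T A f) (restrict (follow T η) α) := by
  have heq : ∀ i < α, η i = Function.update η α a i := fun i hi => by
    rw [Function.update_of_ne hi.ne]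
  obtain ⟨j, hj⟩ := exists_succ hinf α
  rw [restrict_follow_congr heq]
  refine mem_succSet_restrict hinf thin_downClosed ((lt_succ_iff hj).2 le_rfl)
    (restrict_mem_thin fun i hi => ?_)
  rcases ((lt_succ_iff hj).1 hi).lt_or_eq with hi | rfl
  · exact obeys_congr heq hi (h i hi)
  · unfold Obeys
    rw [← restrict_congr heq, ← restrict_follow_congr heq, Function.update_self]
    exact ⟨hA, hA'⟩

/-- The nodes of the thinned tree read from members of `A` keep all successors. -/
theorem succSet_thin_of_mem (hinf : ℵ₀ ≤ lam) (hT : IsCompleteTree T) {η : Idx lam → Idx lam}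
    {α : Idx lam} (h : ∀ i < α, Obeys T A f η i) (hA : restrict η α ∈ A) :
    succSet (thin T A f) (restrict (follow T η) α) = succSet T (restrict (follow T η) α) := by
  refine (succSet_mono (thin_subset hinf hT) _).antisymm fun a ha => ?_
  have := follow_update_mem_succSet_thin hinf h (fun _ => ha) (fun h' => (h' hA).elim)
  rwa [follow_of_mem, Function.update_self] at this
  rw [Function.update_self, ← restrict_follow_congr (η := η)]
  · exact ha
  · exact fun i hi => by rw [Function.update_of_ne hi.ne]

/-- The nodes of the thinned tree read from sequences outside of `A` keep a single successor. -/
theorem succSet_thin_of_notMem (hinf : ℵ₀ ≤ lam) {η : Idx lam → Idx lam}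
    {α : Idx lam} (h : ∀ i < α, Obeys T A f η i) (hA : restrict η α ∉ A) :
    ∃ a, succSet (thin T A f) (restrict (follow T η) α) = {a} := by
  refine ⟨_, Set.eq_singleton_iff_unique_mem.2 ⟨follow_update_mem_succSet_thin hinf h
    (fun h' => (hA h').elim) (fun _ => rfl), ?_⟩⟩
  rintro a ⟨s, ⟨η', hs, ho⟩, -, hle, hlt, rfl⟩
  rw [restrict_len] at hlt
  rw [hs] at hle
  have heq := (restrict_le_restrict.1 (eq_of_restrict_follow_le h ho hle)).2
  have h1 : η' α = f (restrict η α) := by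
    rw [(ho α hlt).2 (by rwa [restrict_congr heq]), restrict_congr heq]
  have h2 : s.val α hlt = follow T η' α := by
    rw [← toFun_of_lt hlt]
    conv_lhs => rw [hs]
    exact toFun_restrict hlt
  refine h2.trans ?_
  rw [follow_apply, follow_apply, h1, Function.update_self]
  congr 1
  refine restrict_follow_congr fun i hi => ?_
  rw [Function.update_of_ne hi.ne, heq i hi]

/-- A compatible family of sequences obeying the thinning rule has a union, and this union
obeys the thinning rule. -/
theorem exists_isUnion_obeys {ι : Type v} {t : ι → Seq lam}
    (hc : ∀ i j, t i ≤ t j ∨ t j ≤ t i) {δ : Idx lam} (hδ : ∀ i, (t i).len ≤ δ)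
    {η : ι → Idx lam → Idx lam} (ht : ∀ i, t i = restrict (follow T (η i)) (t i).len)
    (ho : ∀ i, ∀ k < (t i).len, Obeys T A f (η i) k) :
    ∃ s : Seq lam, IsUnion (fun i => restrict (η i) (t i).len) s ∧
      (∀ k < s.len, Obeys T A f s.toFun k) ∧ IsUnion t (restrict (follow T s.toFun) s.len) := by
  have hle : ∀ {i j}, t i ≤ t j → restrict (η i) (t i).len ≤ restrict (η j) (t j).len :=
    fun {i j} h => eq_of_restrict_follow_le (ho i) (ho j) (by rwa [← ht i, ← ht j])
  obtain ⟨s, hs⟩ := Seq.exists_isUnion (fun i => restrict (η i) (t i).len)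
    (fun i j => (hc i j).imp hle hle) δ hδ
  have heq : ∀ i, (t i).len ≤ s.len ∧ ∀ k < (t i).len, s.toFun k = η i k :=
    fun i => restrict_le_iff.1 (hs.1 i)
  refine ⟨s, hs, fun k hk => ?_, fun i => ?_, hs.2⟩
  · obtain ⟨i, hi⟩ := hs.2 k hk
    exact obeys_congr (fun k hk => ((heq i).2 k hk).symm) hi (ho i k hi)
  · rw [ht i, ← restrict_follow_congr (heq i).2]
    exact restrict_mono _ (heq i).1

/-- A chain in the thinned tree is bounded because its nodes are read from a chain of sequences
obeying the rule, and the branch read from the union of the latter passes through the former. -/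
theorem isCompleteTree_thin (hinf : ℵ₀ ≤ lam) (hT : IsCompleteTree T) :
    IsCompleteTree (thin T A f) where
  downClosed := thin_downClosed
  chainBound c hc hchain hcard := by
    obtain ⟨u, -, hu⟩ := hT.chainBound c (hc.trans (thin_subset hinf hT)) hchain hcard
    choose η ht ho using fun t : c => hc t.2
    obtain ⟨s, -, h, h'⟩ := exists_isUnion_obeys (t := fun t : c => t.1)
      (fun i j => hchain.total i.2 j.2) (fun i => len_mono (hu _ i.2)) ht ho
    exact ⟨_, restrict_mem_thin h, fun t ht => h'.1 ⟨t, ht⟩⟩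
  extends_ := by
    rintro t ⟨η, ht, ho⟩
    have : (succSet (thin T A f) t).Nonempty := by
      rw [ht]
      by_cases hA : restrict η t.len ∈ A
      · rw [succSet_thin_of_mem hinf hT ho hA]
        exact succSet_nonempty hinf hT (follow_mem_branches hinf hT η _)
      · obtain ⟨a, ha⟩ := succSet_thin_of_notMem hinf ho hA
        rw [ha]
        exact Set.singleton_nonempty a
    obtain ⟨a, s, hs, -, hle, hlt, -⟩ := this
    exact ⟨s, hs, hle.lt_of_ne fun h => by simp [h] at hlt⟩

theorem splits_thin_iff (hinf : ℵ₀ ≤ lam) (hT : IsCompleteTree T)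
    (hA : ∀ s ∈ A, Splits T (restrict (follow T s.toFun) s.len)) {η : Idx lam → Idx lam}
    {α : Idx lam} (h : ∀ i < α, Obeys T A f η i) :
    Splits (thin T A f) (restrict (follow T η) α) ↔ restrict η α ∈ A := by
  constructor
  · intro hs
    by_contra h'
    obtain ⟨a, ha⟩ := succSet_thin_of_notMem hinf h h'
    rw [Splits, ha] at hs
    exact Set.not_nontrivial_singleton hs
  · intro h'
    rw [Splits, succSet_thin_of_mem hinf hT h h']
    have := hA _ h'
    rwa [restrict_len, restrict_follow_congr fun i hi => toFun_restrict hi] at this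

/-- The thinned tree is in `Q2` provided that `A` is a set of sequences from which splitting nodes
of `T` are read, `A` is closed under unions, and following the rule above any sequence one
eventually arrives at a member of `A`. -/
theorem thin_mem_Q2 (hinf : ℵ₀ ≤ lam) (hT : IsClubTree T)
    (hA : ∀ s ∈ A, Splits T (restrict (follow T s.toFun) s.len))
    (hunion : ∀ (j : Idx lam) (c : Set.Iio j → Seq lam), Nonempty (Set.Iio j) →
      (∀ i, c i ∈ A) → ∀ s, IsUnion c s → s ∈ A)
    (hdense : ∀ s : Seq lam, (∀ i < s.len, Obeys T A f s.toFun i) →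
      ∃ a ∈ A, s ≤ a ∧ ∀ i < a.len, Obeys T A f a.toFun i) :
    thin T A f ∈ Q2 lam := by
  have hcomp : IsCompleteTree (thin T A f) := isCompleteTree_thin hinf hT.complete
  refine ⟨⟨hcomp, ?_, ?_⟩, ?_⟩
  · rintro t ⟨η, ht, ho⟩
    rw [ht]
    by_cases h : restrict η t.len ∈ A
    · right
      have hs := (splits_thin_iff hinf hT.complete hA ho).2 h
      rw [Splits, succSet_thin_of_mem hinf hT.complete ho h] at hs
      rw [succSet_thin_of_mem hinf hT.complete ho h]
      exact isClub_succSet_of_splits hT (follow_mem_branches hinf hT.complete η _) hs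
    · exact Or.inl (succSet_thin_of_notMem hinf ho h)
  · intro t ht
    -- Pass to a proper extension first, so that the splitting node found is a proper one.
    obtain ⟨t', ⟨η, ht', ho⟩, hlt⟩ := hcomp.extends_ t ht
    obtain ⟨a, haA, hle, ha⟩ := hdense (restrict η t'.len) fun i hi =>
      obeys_congr (fun i hi => (toFun_restrict hi).symm) hi (ho i hi)
    refine ⟨_, restrict_mem_thin ha, hlt.trans_le ?_,
      (splits_thin_iff hinf hT.complete hA ha).2 (by rwa [restrict_toFun])⟩
    rw [restrict_le_iff] at hle
    conv_lhs => rw [ht', ← restrict_follow_congr hle.2]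
    exact restrict_mono _ hle.1
  · intro j t hne hmono h
    choose η ht ho using fun i => (h i).1
    obtain ⟨u, -, hu⟩ := hcomp.exists_isUnion t hmono.monotone fun i => (h i).1
    obtain ⟨s, hs, hs', hts⟩ := exists_isUnion_obeys
      (fun i j => (le_total i j).imp (fun h => hmono.monotone h) fun h => hmono.monotone h)
      (fun i => len_mono (hu.1 i)) ht ho
    refine ⟨_, restrict_mem_thin hs', hts, (splits_thin_iff hinf hT.complete hA hs').2 ?_⟩
    rw [restrict_toFun]
    refine hunion j _ hne (fun i => (splits_thin_iff hinf hT.complete hA (ho i)).1 ?_) s hs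
    rw [← ht i]
    exact (h i).2

end thin

/-! ### Density of `Q2` in `Q1` -/

/-- If `A` is dense above `r`, then there is a way to prescribe values outside of `A` such that any
sequence obeying the prescription has an extension in `A` that obeys the prescription: first run
along `r`, and then run from any sequence outside of `A` to the member of `A` above it that is least
in a fixed well-order. -/
theorem exists_prescription (T : Set (Seq lam)) {A : Set (Seq lam)} {r : Seq lam}
    (hr : ∀ a ∈ A, r ≤ a) (hdense : ∀ s, r ≤ s → ∃ a ∈ A, s ≤ a) :
    ∃ f : Seq lam → Idx lam, ∀ s : Seq lam, (∀ i < s.len, Obeys T A f s.toFun i) →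
      ∃ a ∈ A, s ≤ a ∧ ∀ i < a.len, Obeys T A f a.toFun i := by
  classical
  let least : Seq lam → Seq lam := fun s =>
    if h : ∃ a ∈ A, s ≤ a then (IsWellFounded.wf (r := WellOrderingRel)).min {a | a ∈ A ∧ s ≤ a} h
    else s
  have hleast : ∀ s, (∃ a ∈ A, s ≤ a) → least s ∈ A ∧ s ≤ least s := fun s h => by
    simp only [least, dif_pos h]
    exact WellFounded.min_mem _ {a | a ∈ A ∧ s ≤ a} h
  -- The least member above `s` remains the least one along the way from `s` to it.
  have hstable : ∀ s s', r ≤ s → s ≤ s' → s' ≤ least s → least s' = least s := by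
    intro s s' hrs hss' hs'
    have h1 : ∃ a ∈ A, s ≤ a := hdense s hrs
    have h2 : ∃ a ∈ A, s' ≤ a := hdense s' (hrs.trans hss')
    have e1 : least s = IsWellFounded.wf.min {a | a ∈ A ∧ s ≤ a} h1 := dif_pos h1
    have e2 : least s' = IsWellFounded.wf.min {a | a ∈ A ∧ s' ≤ a} h2 := dif_pos h2
    have n1 : ¬ WellOrderingRel (least s) (least s') := by
      rw [e2]
      exact WellFounded.not_lt_min _ {a | a ∈ A ∧ s' ≤ a} ⟨(hleast s h1).1, hs'⟩
    have n2 : ¬ WellOrderingRel (least s') (least s) := by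
      rw [e1]
      exact WellFounded.not_lt_min _ {a | a ∈ A ∧ s ≤ a}
        ⟨(hleast s' h2).1, hss'.trans (hleast s' h2).2⟩
    exact (trichotomous_of WellOrderingRel (least s') (least s)).resolve_left n2 |>.resolve_right n1
  let f : Seq lam → Idx lam := fun s =>
    if s.len < r.len then r.toFun s.len else (least s).toFun s.len
  have hfr : ∀ {η : Idx lam → Idx lam} {i}, i < r.len →
      (Obeys T A f η i ↔ η i = r.toFun i) := by
    intro η i hi
    have hA : restrict η i ∉ A := fun h => (len_mono (hr _ h)).not_gt hi
    have hf : f (restrict η i) = r.toFun i := if_pos hi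
    simp [Obeys, hA, hf]
  refine ⟨f, fun s hs => ?_⟩
  -- Extend `s` to a sequence above `r`.
  obtain ⟨s, hs, hss', hrs⟩ : ∃ s' : Seq lam, (∀ i < s'.len, Obeys T A f s'.toFun i) ∧
      s ≤ s' ∧ r ≤ s' := by
    rcases le_total s.len r.len with h | h
    · exact ⟨r, fun i hi => (hfr hi).2 rfl,
        le_iff.2 ⟨h, fun i hi => ((hfr (hi.trans_le h)).1 (hs i hi)).symm⟩, le_rfl⟩
    · exact ⟨s, hs, le_rfl, le_iff.2 ⟨h, fun i hi => (hfr hi).1 (hs i (hi.trans_le h))⟩⟩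
  obtain ⟨hbA, hsb⟩ := hleast s (hdense s hrs)
  set b := least s
  -- Follow `b` up to the first level at which an element of `A` is reached.
  obtain ⟨k, ⟨hsk, hkb, hkA⟩, hmin⟩ := WellFounded.has_min (wellFounded_lt (α := Idx lam))
    {k | s.len ≤ k ∧ k ≤ b.len ∧ restrict b.toFun k ∈ A}
    ⟨b.len, len_mono hsb, le_rfl, by rwa [restrict_toFun]⟩
  have hsk' : s ≤ restrict b.toFun k := by
    rw [← restrict_toFun b, le_restrict_iff] at hsb
    exact le_restrict_iff.2 ⟨hsk, hsb.2⟩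
  refine ⟨_, hkA, hss'.trans hsk', fun i hi => ?_⟩
  refine obeys_congr (α := k) (fun i hi => (toFun_restrict hi).symm) hi ?_
  rw [restrict_len] at hi
  rcases lt_or_ge i s.len with his | his
  · exact obeys_congr (α := s.len) (fun i hi => ((le_iff.1 hsb).2 i hi).symm) his (hs i his)
  · have hiA : restrict b.toFun i ∉ A := fun h => hmin i ⟨his, hi.le.trans hkb, h⟩ hi
    have hsi : s ≤ restrict b.toFun i := by
      rw [← restrict_toFun b, le_restrict_iff] at hsb
      exact le_restrict_iff.2 ⟨his, hsb.2⟩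
    have hf : f (restrict b.toFun i) = b.toFun i := by
      have hir : ¬ (restrict b.toFun i).len < r.len := ((len_mono hrs).trans his).not_gt
      have hlb : least (restrict b.toFun i) = b :=
        hstable s _ hrs hsi (restrict_toFun_le (hi.le.trans hkb))
      simp only [f, if_neg hir, hlb, restrict_len]
    exact ⟨fun h => (hiA h).elim, fun _ => hf.symm⟩

/-- Below every tree in `Q1` there is a tree in `Q2`: thin out the tree along the conditions that
decide a club of splitting levels. -/
theorem exists_mem_Q2_subset (hreg : lam.IsRegular) (hunc : ℵ₀ < lam) (hAx : AxPlus lam)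
    {T : Set (Seq lam)} (hT : T ∈ Q1 lam) : ∃ T' ∈ Q2 lam, T' ⊆ T := by
  obtain ⟨X, r, hX, hsplit⟩ := exists_club_splits hreg.aleph0_le hAx hT
  obtain ⟨f, hf⟩ := exists_prescription T (A := decidingConditions X r) (fun a ha => ha.1)
    fun s hs => exists_le_mem_decidingConditions hreg hunc hX hs
  exact ⟨thin T (decidingConditions X r) f, thin_mem_Q2 hreg.aleph0_le hT.1 hsplit
    (fun j c _ h s hs => isUnion_mem_decidingConditions hX h hs) hf,
    thin_subset hreg.aleph0_le hT.1.complete⟩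

end ClubTrees

theorem proposition4p4 (lam : Cardinal.{u}) (hreg : lam.IsRegular) (hunc : ℵ₀ < lam)
    (hpow : lam ^< lam = lam) (hAx : ClubTrees.AxPlus lam) :
    ClubTrees.Q2 lam ⊆ ClubTrees.Q1 lam ∧
      (∀ T ∈ ClubTrees.Q1 lam, ∃ T' ∈ ClubTrees.Q2 lam, T' ⊆ T) ∧
      ClubTrees.ForcingEquivalent (ClubTrees.TreeForcing (ClubTrees.Q1 lam))
        (ClubTrees.TreeForcing (ClubTrees.Q2 lam)) := by
  have hsub := ClubTrees.Q2_subset_Q1 hreg.aleph0_le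
  have hdense := fun T hT => ClubTrees.exists_mem_Q2_subset (T := T) hreg hunc hAx hT
  refine ⟨hsub, hdense, ClubTrees.forcingEquivalent_of_dense
    (fun q => OrderDual.toDual ⟨(OrderDual.ofDual q).1, hsub (OrderDual.ofDual q).2⟩)
    (fun a b => Iff.rfl) fun p => ?_⟩
  obtain ⟨T', hT', hle⟩ := hdense _ (OrderDual.ofDual p).2
  exact ⟨OrderDual.toDual ⟨T', hT'⟩, hle⟩
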